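/- Let $n \geq 3$ and let $X$ be a real $n$-dimensional normed space. Then $X$ has an $(n-1)$-dimensional subspace $Y$ such that $\lambda(Y, X) < 2 - \frac{2}{n}$. Here $\lambda(Y, X) = \inf \|P\|$ is the relative projection constant, the infimum of the operator norms being taken over all bounded linear operators $P : X \to Y$ with $P|_Y = \mathrm{id}_Y$. -/

import Mathlib

/-- The set of all projections of `X` onto its subspace `Y`: the bounded linear operators
`P : X → Y` whose restriction to `Y` is the identity. -/
def projections {X : Type*} [NormedAddCommGroup X] [NormedSpace ℝ X] (Y : Submodule ℝ X) :
    Set (X →L[ℝ] Y) :=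
  {P | ∀ y : Y, P (y : X) = y}

/-- The relative projection constant `λ(Y, X)`: the infimum of the operator norms of all
projections of `X` onto `Y`. The norms are bounded below by `0`, and for finite-dimensional `X`
the set of projections is nonempty (`projections_nonempty`), so this is a genuine infimum. -/
noncomputable def relProjConst {X : Type*} [NormedAddCommGroup X] [NormedSpace ℝ X]
    (Y : Submodule ℝ X) : ℝ :=
  sInf ((fun P : X →L[ℝ] Y => ‖P‖) '' projections Y)

theorem projections_nonempty {X : Type*} [NormedAddCommGroup X] [NormedSpace ℝ X]
    [FiniteDimensional ℝ X] (Y : Submodule ℝ X) : (projections Y).Nonempty := by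
  obtain ⟨f, hf⟩ := Y.subtype.exists_leftInverse_of_injective Y.ker_subtype
  exact ⟨LinearMap.toContinuousLinearMap f, fun y => LinearMap.congr_fun hf y⟩

/-! Suppose every hyperplane has constant at least 2 - 2/n. For `ker f`, minimax duality
(`exists_dual_certificate`) yields at most n weighted pairs (g i, y i) such that the weighted sum of
the f (y i) • g i is a multiple of f. Equality in Bohnenblust's estimate (`bohnenblust_equality`)
then forces exactly n pairs with g i (y i) = 1 and g i (y j) = -1 for i ≠ j. So each g i attains its
norm on the spanning set of vectors ± y j, and f is proportional to a sum of n functionals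
supporting the unit ball along facets. There are only countably many of these
(`countable_facetFunctionals`), hence countably many such hyperplanes, whereas a pencil of
hyperplanes is uncountable. -/

/-! ### Bohnenblust's estimate: the equality case -/

/-- Equality analysis in Bohnenblust's estimate. -/
theorem bohnenblust_equality {ι : Type*} [Fintype ι] [DecidableEq ι] {n : ℕ} (hn : 3 ≤ n)
    (hcard : Fintype.card ι ≤ n) {w F : ι → ℝ} {a : ι → ι → ℝ} {c : ℝ}
    (hw : ∑ i, w i = 1) (hw0 : ∀ i, 0 < w i) (hF : ∀ i, 0 ≤ F i)
    (ha : ∀ i j, |a i j| ≤ 1) (hS : 0 < ∑ i, w i * F i)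
    (hc : ∀ j, ∑ i, w i * F i * a i j = c * F j)
    (htr : 2 - 2 / (n : ℝ) ≤ ∑ i, w i * a i i - c) :
    Fintype.card ι = n ∧ (∃ k, k ≠ 0 ∧ ∀ i, w i * F i = k) ∧ c ≠ 0 ∧
      (∀ i, a i i = 1) ∧ ∀ i j, i ≠ j → a i j = -1 := by
  set S := ∑ i, w i * F i with hSdef
  have hn' : (3 : ℝ) ≤ n := by exact_mod_cast hn
  have hn0 : (0 : ℝ) < n := by linarith
  have hcard' : (Fintype.card ι : ℝ) ≤ n := by exact_mod_cast hcard
  have ha1 : ∀ i j, a i j ≤ 1 := fun i j => (abs_le.mp (ha i j)).2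
  have ha2 : ∀ i j, -1 ≤ a i j := fun i j => (abs_le.mp (ha i j)).1
  have hwF : ∀ i, 0 ≤ w i * F i := fun i => mul_nonneg (hw0 i).le (hF i)
  set r : ℝ := (n : ℝ)⁻¹ with hr
  have hnr : n * r = 1 := mul_inv_cancel₀ hn0.ne'
  have h2n : 2 / (n : ℝ) = 2 * r := by rw [div_eq_mul_inv]
  rw [h2n] at htr
  have hr0 : 0 < r := by positivity
  have hdiag : ∀ j, w j * (1 - a j j) ≤ 1 - ∑ i, w i * a i i := by
    intro j
    have h := Finset.single_le_sum (f := fun i => w i * (1 - a i i))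
      (fun i _ => mul_nonneg (hw0 i).le (sub_nonneg.2 (ha1 i i))) (Finset.mem_univ j)
    simp only [mul_sub, mul_one, Finset.sum_sub_distrib, hw] at h ⊢
    exact h
  -- Bound the j-th column sum of w i * F i * (1 + a i j) below by its diagonal term; a j j cancels
  -- against the bound on -c.
  have hstar : ∀ j, F j * (1 - 2 * r) + 2 * (w j * F j) ≤ S := by
    intro j
    have h := Finset.single_le_sum (f := fun i => w i * F i * (1 + a i j))
      (fun i _ => mul_nonneg (hwF i) (by linarith [ha2 i j])) (Finset.mem_univ j)
    simp only [mul_add, mul_one, Finset.sum_add_distrib, hc] at h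
    have h3 := mul_le_mul_of_nonneg_right
      (show 1 - 2 * r + w j * (1 - a j j) ≤ -c by linarith [hdiag j]) (hF j)
    nlinarith
  have hsq : ∑ j, w j * (w j * F j) ≤ r * S := by
    have h := Finset.sum_le_sum fun j (_ : j ∈ Finset.univ) =>
      mul_le_mul_of_nonneg_left (hstar j) (hw0 j).le
    rw [← Finset.sum_mul, hw] at h
    have e : ∑ j, w j * (F j * (1 - 2 * r) + 2 * (w j * F j))
        = (1 - 2 * r) * S + 2 * ∑ j, w j * (w j * F j) := by
      rw [hSdef, Finset.mul_sum, Finset.mul_sum, ← Finset.sum_add_distrib]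
      exact Finset.sum_congr rfl fun j _ => by ring
    linarith
  have hlin : r * ∑ j, F j ≤ S := by
    have h := Finset.sum_le_sum fun j (_ : j ∈ Finset.univ) => hstar j
    rw [Finset.sum_add_distrib, ← Finset.sum_mul, ← Finset.mul_sum, Finset.sum_const,
      Finset.card_univ, nsmul_eq_mul] at h
    have h4 : (Fintype.card ι : ℝ) * S ≤ n * S := mul_le_mul_of_nonneg_right hcard' hS.le
    have h5 : (∑ j, F j) * (1 - 2 * r) ≤ (n - 2) * S := by linarith
    have h6 : (1 - 2 * r) = (n - 2) * r := by linarith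
    rw [h6] at h5
    have h7 : (n - 2) * (r * ∑ j, F j) ≤ (n - 2) * S := by linarith
    exact le_of_mul_le_mul_left h7 (by linarith)
  -- Averaging `hstar` with weights w and with equal weights bounds the two outer terms of the
  -- expanded square, so the variance of w about 1/n, weighted by F, vanishes.
  have hQ : ∑ j, F j * (w j - r) ^ 2 ≤ 0 := by
    have e : ∑ j, F j * (w j - r) ^ 2
        = ∑ j, w j * (w j * F j) - 2 * r * S + r * (r * ∑ j, F j) := by
      rw [hSdef, Finset.mul_sum, Finset.mul_sum, Finset.mul_sum, ← Finset.sum_sub_distrib,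
        ← Finset.sum_add_distrib]
      exact Finset.sum_congr rfl fun j _ => by ring
    have := mul_le_mul_of_nonneg_left hlin hr0.le
    linarith
  have hQ0 : ∀ j, F j * (w j - r) ^ 2 = 0 := by
    have hnn : ∀ j ∈ Finset.univ, 0 ≤ F j * (w j - r) ^ 2 :=
      fun j _ => mul_nonneg (hF j) (sq_nonneg _)
    have := (Finset.sum_eq_zero_iff_of_nonneg hnn).1 (le_antisymm hQ (Finset.sum_nonneg hnn))
    exact fun j => this j (Finset.mem_univ j)
  have hwr : ∀ j, w j * F j = r * F j := by
    intro j
    rcases mul_eq_zero.1 (hQ0 j) with h | h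
    · simp [h]
    · rw [sub_eq_zero.1 (pow_eq_zero_iff two_ne_zero |>.1 h)]
  have hFS : ∀ j, F j ≤ S := fun j => by nlinarith [hstar j, hwr j]
  have hSsum : n * S = ∑ j, F j := by
    rw [hSdef, Finset.sum_congr rfl fun j _ => hwr j, ← Finset.mul_sum, ← mul_assoc, hnr, one_mul]
  have hcS : ∑ j, (S - F j) = Fintype.card ι * S - n * S := by
    rw [Finset.sum_sub_distrib, Finset.sum_const, Finset.card_univ, nsmul_eq_mul, hSsum]
  have hnn : ∀ j ∈ Finset.univ, 0 ≤ S - F j := fun j _ => sub_nonneg.2 (hFS j)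
  have hcardS : (Fintype.card ι : ℝ) * S ≤ n * S := mul_le_mul_of_nonneg_right hcard' hS.le
  have hz : ∑ j, (S - F j) = 0 := le_antisymm (by linarith) (Finset.sum_nonneg hnn)
  -- At most n values F j, each at most S, add up to n * S.
  have hFe : ∀ j, F j = S := fun j => by
    linarith [(Finset.sum_eq_zero_iff_of_nonneg hnn).1 hz j (Finset.mem_univ j)]
  have hcn : (Fintype.card ι : ℝ) = n := mul_right_cancel₀ hS.ne' (by linarith)
  have hwe : ∀ j, w j = r := fun j => by
    have := hwr j
    rw [hFe j] at this
    exact mul_right_cancel₀ hS.ne' this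
  have hcol : ∀ j, ∑ i, a i j = n * c := by
    intro j
    have h := hc j
    simp only [hwe, hFe] at h
    rw [← Finset.mul_sum] at h
    have h' : S * (r * ∑ i, a i j) = S * c := by linarith
    have h'' := mul_left_cancel₀ hS.ne' h'
    rw [← h'', ← mul_assoc, hnr, one_mul]
  set T := ∑ i, a i i with hT
  have htr' : n * c ≤ 2 - 2 * n + T := by
    simp only [hwe, ← Finset.mul_sum] at htr
    have := mul_le_mul_of_nonneg_left htr hn0.le
    have e : (n : ℝ) * (r * ∑ i, a i i - c) = T - n * c := by
      rw [mul_sub, ← mul_assoc, hnr, one_mul]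
    nlinarith
  have hoff : ∀ j, ∑ i ∈ Finset.univ.erase j, (1 + a i j) = n * c + (n - 1) - a j j := by
    intro j
    have h := Finset.add_sum_erase Finset.univ (fun i => 1 + a i j) (Finset.mem_univ j)
    have e : ∑ i, (1 + a i j) = n + n * c := by
      rw [Finset.sum_add_distrib, hcol, Finset.sum_const, Finset.card_univ, nsmul_eq_mul, hcn,
        mul_one]
    linarith
  have hoffnn : ∀ j, ∀ i ∈ Finset.univ.erase j, 0 ≤ 1 + a i j :=
    fun j i _ => by linarith [ha2 i j]
  have hge : ∀ j, 0 ≤ n * c + (n - 1) - a j j :=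
    fun j => hoff j ▸ Finset.sum_nonneg (hoffnn j)
  -- Summing `hge` over j and inserting `htr'` leaves (n - 1) * (T - n) ≥ 0.
  have hTn : (n : ℝ) ≤ T := by
    have h := Finset.sum_nonneg fun j (_ : j ∈ Finset.univ) => hge j
    rw [Finset.sum_sub_distrib, Finset.sum_const, Finset.card_univ, nsmul_eq_mul, hcn] at h
    have h8 := mul_le_mul_of_nonneg_left htr' hn0.le
    have : 0 ≤ ((n : ℝ) - 1) * (T - n) := by nlinarith
    have := nonneg_of_mul_nonneg_right this (by linarith)
    linarith
  have hd : ∀ i, a i i = 1 := by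
    have hnn : ∀ j ∈ Finset.univ, 0 ≤ 1 - a j j := fun j _ => sub_nonneg.2 (ha1 j j)
    have h0 : ∑ j, (1 - a j j) ≤ 0 := by
      rw [Finset.sum_sub_distrib, Finset.sum_const, Finset.card_univ, nsmul_eq_mul, hcn]
      linarith
    intro i
    linarith [(Finset.sum_eq_zero_iff_of_nonneg hnn).1 (le_antisymm h0 (Finset.sum_nonneg hnn)) i
      (Finset.mem_univ i)]
  have hTe : T = n := by
    rw [hT, Finset.sum_congr rfl fun i _ => hd i, Finset.sum_const, Finset.card_univ,
      nsmul_eq_mul, hcn, mul_one]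
  refine ⟨by exact_mod_cast hcn, ⟨r * S, (mul_pos hr0 hS).ne', fun i => by rw [hwe, hFe]⟩, ?_, hd,
    ?_⟩
  · rintro rfl
    rw [mul_zero, hTe] at htr'
    linarith
  · intro i j hij
    have h0 : ∑ i ∈ Finset.univ.erase j, (1 + a i j) = 0 :=
      le_antisymm (by rw [hoff, hd]; linarith) (Finset.sum_nonneg (hoffnn j))
    linarith [(Finset.sum_eq_zero_iff_of_nonneg (hoffnn j)).1 h0 i (by simp [hij])]

/-! ### Finite-dimensional duality and convex hulls -/

theorem exists_eval_eq_of_finiteDimensional {X : Type*} [NormedAddCommGroup X] [NormedSpace ℝ X]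
    [FiniteDimensional ℝ X] (φ : StrongDual ℝ (StrongDual ℝ X)) :
    ∃ x : X, ∀ g : StrongDual ℝ X, φ g = g x := by
  let ψ : Module.Dual ℝ (Module.Dual ℝ X) :=
    φ.toLinearMap ∘ₗ (LinearMap.toContinuousLinearMap (𝕜 := ℝ) (E := X) (F' := ℝ)).toLinearMap
  obtain ⟨x, hx⟩ := (Module.evalEquiv ℝ X).surjective ψ
  refine ⟨x, fun g => ?_⟩
  have h := LinearMap.congr_fun hx g.toLinearMap
  simp only [Module.evalEquiv_apply] at h
  have e : ψ g.toLinearMap = φ g := by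
    change φ (LinearMap.toContinuousLinearMap g.toLinearMap) = φ g
    congr 1
  rw [← e, ← h]
  rfl

/-- By Carathéodory, the hull is a continuous image of the simplex times a power of K; shorter
combinations are padded with weight 0 at a point p of K. -/
theorem IsCompact.convexHull_of_finiteDimensional {V : Type*} [NormedAddCommGroup V]
    [NormedSpace ℝ V] [FiniteDimensional ℝ V] {K : Set V} (hK : IsCompact K) :
    IsCompact (convexHull ℝ K) := by
  rcases K.eq_empty_or_nonempty with rfl | ⟨p, hp⟩
  · simp
  set d := Module.finrank ℝ V + 1
  have hcomp : IsCompact ((fun q : (Fin d → ℝ) × (Fin d → V) => ∑ i, q.1 i • q.2 i) ''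
      (stdSimplex ℝ (Fin d) ×ˢ Set.univ.pi fun _ => K)) :=
    ((isCompact_stdSimplex ℝ (Fin d)).prod (isCompact_univ_pi fun _ => hK)).image (by fun_prop)
  convert hcomp using 1
  apply Set.Subset.antisymm
  · intro x hx
    obtain ⟨ι, _, z, w, hz, hind, hw0, hw1, rfl⟩ := eq_pos_convex_span_of_mem_convexHull hx
    have hcard : Fintype.card ι ≤ Fintype.card (Fin d) := by
      rw [Fintype.card_fin]
      exact hind.card_le_finrank_succ.trans (Nat.succ_le_succ (Submodule.finrank_le _))
    obtain ⟨e⟩ := Function.Embedding.nonempty_of_card_le hcard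
    have key : ∀ i, Function.extend e w (0 : Fin d → ℝ) (e i) = w i := e.injective.extend_apply w _
    have key2 : ∀ i, Function.extend e z (fun _ => p) (e i) = z i :=
      e.injective.extend_apply z _
    have hout : ∀ j, j ∉ Set.range e → Function.extend e w (0 : Fin d → ℝ) j = 0 := fun j hj =>
      Function.extend_apply' w _ j hj
    refine ⟨(Function.extend e w 0, Function.extend e z fun _ => p), ⟨⟨fun j => ?_, ?_⟩, ?_⟩, ?_⟩
    · by_cases hj : j ∈ Set.range e
      · obtain ⟨i, rfl⟩ := hj
        exact (hw0 i).le.trans_eq (key i).symm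
      · exact (hout j hj).symm.le
    · rw [← hw1]
      exact (Fintype.sum_of_injective e e.injective _ _ hout fun i => (key i).symm).symm
    · intro j _
      by_cases hj : j ∈ Set.range e
      · obtain ⟨i, rfl⟩ := hj
        exact (key2 i).symm.subst (motive := fun a => a ∈ K) (hz ⟨i, rfl⟩)
      · have := Function.extend_apply' z (fun _ => p) j hj
        exact this.symm.subst (motive := fun a => a ∈ K) hp
    · refine (Fintype.sum_of_injective e e.injective _ _ (fun j hj => ?_) fun i => ?_).symm
      · simp only [hout j hj, zero_smul]
      · simp only [key, key2]
  · rintro _ ⟨⟨w, z⟩, ⟨⟨hw0, hw1⟩, hz⟩, rfl⟩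
    exact (convex_convexHull ℝ K).sum_mem (fun i _ => hw0 i) hw1
      fun i _ => subset_convexHull ℝ K (hz i trivial)

/-- A ray through a compact convex hull meets it in a convex combination of at most `finrank V`
points: the last point of the ray in the hull lies on its boundary. -/
theorem exists_convex_combination_mem_ray {V : Type*} [NormedAddCommGroup V]
    [NormedSpace ℝ V] [FiniteDimensional ℝ V] {K : Set V} (hK : IsCompact K) {v : V} (hv : v ≠ 0)
    (h : ∃ t : ℝ, 0 ≤ t ∧ t • v ∈ convexHull ℝ K) :
    ∃ (m : ℕ) (z : Fin m → V) (w : Fin m → ℝ) (t : ℝ), m ≤ Module.finrank ℝ V ∧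
      (∀ i, z i ∈ K) ∧ (∀ i, 0 < w i) ∧ ∑ i, w i = 1 ∧ 0 ≤ t ∧ ∑ i, w i • z i = t • v := by
  have hc : IsCompact ((fun t : ℝ => t • v) ⁻¹' convexHull ℝ K ∩ Set.Ici 0) :=
    ((isClosedEmbedding_smul_left hv).isCompact_preimage
      hK.convexHull_of_finiteDimensional).inter_right isClosed_Ici
  obtain ⟨t₀, ht₀, ht₀'⟩ := h
  obtain ⟨t, ⟨ht, ht0⟩, hmax⟩ := hc.exists_isMaxOn ⟨t₀, ht₀', ht₀⟩ continuousOn_id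
  obtain ⟨ι, _, z, w, hz, hind, hw0, hw1, hsum⟩ := eq_pos_convex_span_of_mem_convexHull ht
  have hsum : ∑ i, w i • z i = t • v := hsum
  let e := (Fintype.equivFin ι).symm
  refine ⟨Fintype.card ι, z ∘ e, w ∘ e, t, ?_, fun i => hz ⟨_, rfl⟩, fun i => hw0 _,
    by rw [← hw1]; exact e.sum_comp w, ht0, by rw [← hsum]; exact e.sum_comp fun i => w i • z i⟩
  -- With one point more, the points form an affine basis and the positive weights put t • v in the
  -- interior of the hull, so t is not maximal.
  by_contra hlt
  have hle : Fintype.card ι ≤ Module.finrank ℝ V + 1 :=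
    hind.card_le_finrank_succ.trans (Nat.succ_le_succ (Submodule.finrank_le _))
  have htop := hind.affineSpan_eq_top_iff_card_eq_finrank_add_one.2 (by omega)
  let b : AffineBasis ι ℝ V := ⟨z, hind, htop⟩
  have hint : t • v ∈ interior (convexHull ℝ K) := by
    refine interior_mono (convexHull_mono hz) ?_
    have hb : Set.range z = Set.range b := rfl
    rw [hb, b.interior_convexHull]
    intro i
    have h1 := b.coord_apply_combination_of_mem (Finset.mem_univ i) hw1
    rw [Finset.affineCombination_eq_linear_combination _ _ _ hw1] at h1
    have h2 : ∑ i, w i • b i = t • v := hsum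
    rw [← h2, h1]
    exact hw0 i
  have hcont : Filter.Tendsto (fun s : ℝ => s • v) (nhds t) (nhds (t • v)) :=
    (continuous_id.smul continuous_const).tendsto t
  have hev := (hcont.eventually (isOpen_interior.mem_nhds hint)).filter_mono
    (nhdsWithin_le_nhds (s := Set.Ioi t))
  obtain ⟨s, hs, hst⟩ := (hev.and self_mem_nhdsWithin).exists
  have hst : t < s := hst
  have := hmax (show s ∈ (fun t : ℝ => t • v) ⁻¹' convexHull ℝ K ∩ Set.Ici 0 from
    ⟨interior_subset (s := convexHull ℝ K) hs, le_trans ht0 hst.le⟩)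
  exact absurd hst (not_lt.2 this)

/-! ### Facet functionals -/

/-- The functionals of norm at most one that attain the norm on a spanning subset of the unit
ball, that is, those supporting the unit ball along a facet. -/
def facetFunctionals (X : Type*) [NormedAddCommGroup X] [NormedSpace ℝ X] :
    Set (StrongDual ℝ X) :=
  {g | ‖g‖ ≤ 1 ∧ Submodule.span ℝ {y : X | ‖y‖ ≤ g y} = ⊤}

/-- The cones where g dominates the norm are convex and spanning, so they have interior points. Two
functionals that both equal the norm on an open set coincide, so the interiors are disjoint, and
separability applies. -/
theorem countable_facetFunctionals (X : Type*) [NormedAddCommGroup X] [NormedSpace ℝ X]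
    [FiniteDimensional ℝ X] : (facetFunctionals X).Countable := by
  have := FiniteDimensional.proper ℝ X
  refine Set.PairwiseDisjoint.countable_of_isOpen
    (s := fun g : StrongDual ℝ X => interior {y : X | ‖y‖ ≤ g y}) ?_ (fun _ _ => isOpen_interior) ?_
  · intro g hg h hh hne
    refine Set.disjoint_left.2 fun y hy hy' => hne ?_
    have hsub : interior {y : X | ‖y‖ ≤ g y} ∩ interior {y : X | ‖y‖ ≤ h y} ⊆
        (LinearMap.ker (g - h).toLinearMap : Set X) := by
      rintro z ⟨hz, hz'⟩
      have e : ∀ k : StrongDual ℝ X, ‖k‖ ≤ 1 → k z ≤ ‖z‖ := fun k hk =>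
        (le_abs_self _).trans ((k.le_of_opNorm_le hk z).trans (one_mul _).le)
      have h1 : ‖z‖ ≤ g z := interior_subset (s := {y : X | ‖y‖ ≤ g y}) hz
      have h2 : ‖z‖ ≤ h z := interior_subset (s := {y : X | ‖y‖ ≤ h y}) hz'
      have h3 := e g hg.1
      have h4 := e h hh.1
      change (g - h) z = 0
      rw [sub_apply]
      linarith
    have htop := Submodule.eq_top_of_nonempty_interior' (LinearMap.ker (g - h).toLinearMap)
      ⟨y, interior_maximal hsub (isOpen_interior.inter isOpen_interior) ⟨hy, hy'⟩⟩
    rw [← sub_eq_zero]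
    ext z
    have : z ∈ LinearMap.ker (g - h).toLinearMap := htop ▸ Submodule.mem_top
    exact this
  · rintro g ⟨-, hg⟩
    have hconv : Convex ℝ {y : X | ‖y‖ ≤ g y} := by
      intro x hx y hy a b ha hb _
      simp only [Set.mem_ofPred_eq, map_add, map_smul, smul_eq_mul] at hx hy ⊢
      calc ‖a • x + b • y‖ ≤ ‖a • x‖ + ‖b • y‖ := norm_add_le _ _
        _ = a * ‖x‖ + b * ‖y‖ := by
          rw [norm_smul, norm_smul, Real.norm_of_nonneg ha, Real.norm_of_nonneg hb]
        _ ≤ a * g x + b * g y := by gcongr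
    rw [hconv.interior_nonempty_iff_affineSpan_eq_top]
    have h0 : (0 : X) ∈ {y : X | ‖y‖ ≤ g y} := by simp
    have h0' : (0 : X) ∈ affineSpan ℝ {y : X | ‖y‖ ≤ g y} := subset_affineSpan ℝ _ h0
    rw [AffineSubspace.affineSpan_eq_top_iff_vectorSpan_eq_top_of_nonempty ℝ X X ⟨0, h0⟩, eq_top_iff,
      ← hg, Submodule.span_le]
    intro y hy
    have := vsub_mem_vectorSpan ℝ hy h0
    rwa [vsub_eq_sub, sub_zero] at this

/-! ### Minimax duality for projections onto a hyperplane -/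

theorem exists_norm_le_one_apply_eq_norm {X : Type*} [NormedAddCommGroup X] [NormedSpace ℝ X]
    (x : X) : ∃ g : StrongDual ℝ X, ‖g‖ ≤ 1 ∧ g x = ‖x‖ := by
  obtain ⟨g, hg, hgx⟩ := exists_dual_vector'' ℝ x
  exact ⟨g, hg, by simpa using hgx⟩

/-- If no projection along a vector onto `ker f` has norm less than `C`, then minimax duality
provides at most `finrank X` pairs of a functional and a vector witnessing this. -/
theorem exists_dual_certificate {X : Type*} [NormedAddCommGroup X] [NormedSpace ℝ X]
    [FiniteDimensional ℝ X] {f : StrongDual ℝ X} (hf : f ≠ 0) {C : ℝ} (hC : 0 < C)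
    (h : ∀ x, f x = 1 → ∀ C' < C, ¬ ∀ y, ‖y‖ ≤ 1 → ‖y - f y • x‖ ≤ C') :
    ∃ (m : ℕ) (g : Fin m → StrongDual ℝ X) (y : Fin m → X) (w : Fin m → ℝ) (c : ℝ),
      m ≤ Module.finrank ℝ X ∧ (∀ i, ‖g i‖ ≤ 1) ∧ (∀ i, ‖y i‖ ≤ 1) ∧ (∀ i, 0 < w i) ∧
      ∑ i, w i = 1 ∧ (∀ i, 0 ≤ f (y i)) ∧ ∑ i, (w i * f (y i)) • g i = c • f ∧
      C ≤ ∑ i, w i * g i (y i) - c := by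
  have := FiniteDimensional.proper ℝ X
  have := FiniteDimensional.proper ℝ (StrongDual ℝ X)
  -- If f x = 1, then q (g, y) takes the value C - g (y - f y • x) at x: the slack in the norm bound
  -- for the projection along x.
  let q : StrongDual ℝ X × X → StrongDual ℝ X := fun p => f p.2 • p.1 - (p.1 p.2 - C) • f
  have hq : Continuous q := by fun_prop
  let K : Set (StrongDual ℝ X) := q '' (Metric.closedBall 0 1 ×ˢ Metric.closedBall 0 1)
  have hK : IsCompact K :=
    ((isCompact_closedBall _ _).prod (isCompact_closedBall _ _)).image hq
  have hmem : ∀ (g : StrongDual ℝ X) (y : X), ‖g‖ ≤ 1 → ‖y‖ ≤ 1 → q (g, y) ∈ K := fun g y hg hy =>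
    ⟨(g, y), ⟨by simpa using hg, by simpa using hy⟩, rfl⟩
  -- Otherwise a separating functional, evaluation at some x, gives after scaling to f x = 1 a
  -- projection of norm below C. Aiming at a ray instead of the origin saves one point in
  -- Carathéodory's bound.
  have hray : ∃ t : ℝ, 0 ≤ t ∧ t • (-f) ∈ convexHull ℝ K := by
    by_contra! hno
    let R : Set (StrongDual ℝ X) := (fun t : ℝ => t • (-f)) '' Set.Ici 0
    have hRc : IsClosed R := (isClosedEmbedding_smul_left (neg_ne_zero.2 hf)).isClosedMap _
      isClosed_Ici
    have hRconv : Convex ℝ R :=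
      (convex_Ici (0 : ℝ)).linear_image (LinearMap.toSpanSingleton ℝ _ (-f))
    have hdisj : Disjoint (convexHull ℝ K) R := by
      rw [Set.disjoint_right]
      rintro _ ⟨t, ht, rfl⟩
      exact hno t ht
    obtain ⟨φ, u, v, hu, huv, hv⟩ := geometric_hahn_banach_compact_closed
      (convex_convexHull ℝ K) hK.convexHull_of_finiteDimensional hRconv hRc hdisj
    obtain ⟨x, hx⟩ := exists_eval_eq_of_finiteDimensional φ
    have hu0 : u < 0 := by
      have := hv _ ⟨0, Set.self_mem_Ici, rfl⟩
      simp only [zero_smul, map_zero] at this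
      linarith
    have hKu : ∀ (g : StrongDual ℝ X) (y : X), ‖g‖ ≤ 1 → ‖y‖ ≤ 1 →
        f y * g x - (g y - C) * f x < u := by
      intro g y hg hy
      have := hu _ (subset_convexHull ℝ K (hmem g y hg hy))
      rw [hx] at this
      simpa [q] using this
    have hfx : f x < 0 := by
      have := hKu 0 0 (by simp) (by simp)
      simp only [map_zero, zero_apply, zero_mul, zero_sub, neg_mul, neg_neg] at this
      exact neg_of_mul_neg_right (this.trans hu0) hC.le
    refine h ((f x)⁻¹ • x) (by simp [hfx.ne]) (C - u / f x)
      (by linarith [div_pos_of_neg_of_neg hu0 hfx]) fun y hy => ?_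
    obtain ⟨g, hg, hgn⟩ := exists_norm_le_one_apply_eq_norm (y - f y • (f x)⁻¹ • x)
    rw [← hgn]
    have := (div_lt_div_right_of_neg hfx).2 (hKu g y hg hy)
    have e : (f y * g x - (g y - C) * f x) / f x = C - g (y - f y • (f x)⁻¹ • x) := by
      simp only [map_sub, map_smul, smul_eq_mul]
      field_simp [hfx.ne]
      ring
    linarith
  obtain ⟨m, z, w, t, hm, hz, hw0, hw1, ht, hsum⟩ :=
    exists_convex_combination_mem_ray hK (neg_ne_zero.2 hf) hray
  have hflip : ∀ i, ∃ (g : StrongDual ℝ X) (y : X), ‖g‖ ≤ 1 ∧ ‖y‖ ≤ 1 ∧ 0 ≤ f y ∧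
      f y • g - (g y - C) • f = z i := by
    intro i
    obtain ⟨⟨g, y⟩, ⟨hg, hy⟩, hgy⟩ := hz i
    rw [mem_closedBall_zero_iff] at hg hy
    -- q is unchanged under (g, y) ↦ (-g, -y).
    rcases le_total 0 (f y) with h0 | h0
    · exact ⟨g, y, hg, hy, h0, hgy⟩
    · refine ⟨-g, -y, by simpa using hg, by simpa using hy, by simpa using h0, ?_⟩
      rw [← hgy]
      simp [q]
  choose g y hg hy hfy hgy using hflip
  refine ⟨m, g, y, w, ∑ i, w i * g i (y i) - C - t, ?_, hg, hy, hw0, hw1, hfy, ?_, by linarith⟩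
  · rwa [← (LinearMap.toContinuousLinearMap (𝕜 := ℝ) (E := X) (F' := ℝ)).finrank_eq,
      Subspace.dual_finrank_eq] at hm
  · have e : ∑ i, w i • z i = ∑ i, (w i * f (y i)) • g i - (∑ i, w i * g i (y i) - C) • f := by
      have e1 : (∑ i, w i * g i (y i) - C) = ∑ i, w i * (g i (y i) - C) := by
        simp only [mul_sub, Finset.sum_sub_distrib, ← Finset.sum_mul, hw1, one_mul]
      rw [e1, Finset.sum_smul, ← Finset.sum_sub_distrib]
      refine Finset.sum_congr rfl fun i _ => ?_
      rw [← hgy, smul_sub, smul_smul, smul_smul]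
    rw [e, sub_eq_iff_eq_add] at hsum
    rw [hsum]
    module

/-! ### Hyperplanes with maximal projection constant -/

/-- Applying g i to a linear relation shows that twice each coefficient equals the sum of all;
summing gives (n - 2) times that sum equal to 0, and n ≠ 2. -/
theorem span_eq_top_of_gram_eq {X : Type*} [NormedAddCommGroup X] [NormedSpace ℝ X]
    [FiniteDimensional ℝ X] {n : ℕ} (hn : 3 ≤ n) (hX : Module.finrank ℝ X = n)
    {g : Fin n → StrongDual ℝ X} {y : Fin n → X} (hd : ∀ i, g i (y i) = 1)
    (ho : ∀ i j, i ≠ j → g i (y j) = -1) : Submodule.span ℝ (Set.range y) = ⊤ := by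
  have hn' : (3 : ℝ) ≤ n := by exact_mod_cast hn
  refine LinearIndependent.span_eq_top_of_card_eq_finrank' ?_ (by simp [hX])
  rw [Fintype.linearIndependent_iff]
  intro b hb
  have key : ∀ i, 2 * b i = ∑ j, b j := by
    intro i
    have h := congrArg (g i) hb
    simp only [map_sum, map_smul, smul_eq_mul, map_zero] at h
    have h2 : ∑ j, b j * g i (y j) + ∑ j, b j = 2 * b i := by
      rw [← Finset.sum_add_distrib, Finset.sum_eq_single i]
      · rw [hd]; ring
      · intro j _ hj
        rw [ho i j hj.symm]; ring
      · simp
    linarith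
  have hs : ∑ i : Fin n, 2 * b i = n * ∑ j, b j := by simp [key]
  rw [← Finset.mul_sum] at hs
  have h0 : ∑ j, b j = 0 := by
    have : ((n : ℝ) - 2) * ∑ j, b j = 0 := by linarith
    exact (mul_eq_zero.1 this).resolve_left (by linarith)
  intro i
  linarith [key i]

/-- A hyperplane with maximal relative projection constant is the kernel of a sum of facet
functionals. -/
theorem exists_facetFunctionals_sum_eq_smul {X : Type*} [NormedAddCommGroup X] [NormedSpace ℝ X]
    [FiniteDimensional ℝ X] {n : ℕ} (hn : 3 ≤ n) (hX : Module.finrank ℝ X = n)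
    {f : StrongDual ℝ X} (hf : f ≠ 0)
    (h : 2 - 2 / (n : ℝ) ≤ relProjConst (LinearMap.ker f.toLinearMap)) :
    ∃ (g : Fin n → facetFunctionals X) (k : ℝ), k ≠ 0 ∧
      ∑ i, (g i : StrongDual ℝ X) = k • f := by
  have hn' : (3 : ℝ) ≤ n := by exact_mod_cast hn
  have h2n : 2 / (n : ℝ) < 1 := (div_lt_one (by linarith)).2 (by linarith)
  have hproj : ∀ x, f x = 1 → ∀ C' < 2 - 2 / (n : ℝ), ¬ ∀ y, ‖y‖ ≤ 1 → ‖y - f y • x‖ ≤ C' := by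
    intro x hx C' hC' hy
    let P : X →L[ℝ] LinearMap.ker f.toLinearMap :=
      (ContinuousLinearMap.id ℝ X - f.smulRight x).codRestrict (LinearMap.ker f.toLinearMap)
        fun y => by simp [hx]
    have hP : P ∈ projections (LinearMap.ker f.toLinearMap) := by
      intro y
      have hy0 : f (y : X) = 0 := y.2
      ext
      simp [P, hy0]
    have hC0 : 0 ≤ C' := (norm_nonneg _).trans (hy 0 (by simp))
    have hPn : ‖P‖ ≤ C' := by
      refine P.opNorm_le_of_unit_norm hC0 fun y hy1 => ?_
      simpa [P] using hy y hy1.le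
    have hle : relProjConst (LinearMap.ker f.toLinearMap) ≤ ‖P‖ :=
      csInf_le ⟨0, by rintro _ ⟨Q, -, rfl⟩; exact norm_nonneg Q⟩ ⟨P, hP, rfl⟩
    linarith
  obtain ⟨m, g, y, w, c, hm, hg, hy, hw0, hw1, hfy, hsum, hc⟩ :=
    exists_dual_certificate hf (by linarith) hproj
  rw [hX] at hm
  have happ : ∀ x, ∑ i, w i * f (y i) * g i x = c * f x := fun x => by
    have := DFunLike.congr_fun hsum x
    simpa using this
  have ha : ∀ i j, |g i (y j)| ≤ 1 := fun i j => by
    have := (g i).le_of_opNorm_le (hg i) (y j)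
    rw [one_mul] at this
    exact this.trans (hy j)
  -- If the sum vanished, then c = 0 and the certificate would be at most 1 < 2 - 2/n.
  have hS : 0 < ∑ i, w i * f (y i) := by
    have hnn : ∀ i ∈ Finset.univ, 0 ≤ w i * f (y i) := fun i _ => mul_nonneg (hw0 i).le (hfy i)
    refine (Finset.sum_nonneg hnn).lt_of_ne fun h0 => ?_
    have hz := (Finset.sum_eq_zero_iff_of_nonneg hnn).1 h0.symm
    have hcf : c • f = 0 := by
      rw [← hsum]
      exact Finset.sum_eq_zero fun i hi => by rw [hz i hi, zero_smul]
    have hc0 := (smul_eq_zero.1 hcf).resolve_right hf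
    have : ∑ i, w i * g i (y i) ≤ 1 := by
      rw [← hw1]
      exact Finset.sum_le_sum fun i _ =>
        mul_le_of_le_one_right (hw0 i).le (abs_le.1 (ha i i)).2
    linarith
  obtain ⟨hcard, ⟨k, hk, hwk⟩, hc0, hd, ho⟩ := bohnenblust_equality hn (by simpa using hm) hw1 hw0
    hfy ha hS (fun j => happ (y j)) hc
  rw [Fintype.card_fin] at hcard
  subst hcard
  have hspan := span_eq_top_of_gram_eq hn hX hd ho
  have hfacet : ∀ i, g i ∈ facetFunctionals X := by
    refine fun i => ⟨hg i, ?_⟩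
    rw [eq_top_iff, ← hspan, Submodule.span_le]
    rintro _ ⟨j, rfl⟩
    by_cases hij : i = j
    · subst hij
      exact Submodule.subset_span ((hy i).trans_eq (hd i).symm)
    · have : -y j ∈ Submodule.span ℝ {x : X | ‖x‖ ≤ g i x} := by
        refine Submodule.subset_span ?_
        change ‖-y j‖ ≤ g i (-y j)
        rw [norm_neg, map_neg, ho i j hij, neg_neg]
        exact hy j
      exact neg_mem_iff.1 this
  refine ⟨fun i => ⟨g i, hfacet i⟩, k⁻¹ * c, mul_ne_zero (inv_ne_zero hk) hc0, ?_⟩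
  simp only [hwk, ← Finset.smul_sum] at hsum
  rw [mul_smul, ← hsum, smul_smul, inv_mul_cancel₀ hk, one_smul]

/-! ### Counting hyperplanes in a pencil -/

theorem corollary2p9 (n : ℕ) (hn : 3 ≤ n)
    (X : Type*) [NormedAddCommGroup X] [NormedSpace ℝ X] (hX : Module.finrank ℝ X = n) :
    ∃ Y : Submodule ℝ X, Module.finrank ℝ Y = n - 1 ∧ relProjConst Y < 2 - 2 / (n : ℝ) := by
  have hfin : FiniteDimensional ℝ X := Module.finite_of_finrank_pos (by omega)
  have hdim : Module.finrank ℝ (StrongDual ℝ X) = n := by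
    rw [← (LinearMap.toContinuousLinearMap (𝕜 := ℝ) (E := X) (F' := ℝ)).finrank_eq,
      Subspace.dual_finrank_eq, hX]
  by_contra! hno
  let b := Module.finBasisOfFinrankEq ℝ (StrongDual ℝ X) hdim
  have hli : LinearIndependent ℝ ![b ⟨0, by omega⟩, b ⟨1, by omega⟩] := by
    have := b.linearIndependent.comp ![⟨0, by omega⟩, ⟨1, by omega⟩] (by
      intro i j hij
      fin_cases i <;> fin_cases j <;> simp_all)
    convert this using 1
    ext i
    fin_cases i <;> rfl
  rw [LinearIndependent.pair_iff] at hli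
  set f₀ := b ⟨0, by omega⟩
  set f₁ := b ⟨1, by omega⟩
  have hne : ∀ t : ℝ, f₀ + t • f₁ ≠ 0 := fun t ht =>
    one_ne_zero (hli 1 t (by rwa [one_smul])).1
  have hker : ∀ t : ℝ, Module.finrank ℝ (LinearMap.ker (f₀ + t • f₁).toLinearMap) = n - 1 := by
    intro t
    have hne' : (f₀ + t • f₁).toLinearMap ≠ 0 := fun h0 =>
      hne t (ContinuousLinearMap.coe_injective h0)
    have := Module.Dual.finrank_ker_add_one_of_ne_zero (f := (f₀ + t • f₁).toLinearMap) hne'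
    omega
  choose G k hk hG using fun t : ℝ =>
    exists_facetFunctionals_sum_eq_smul hn hX (hne t) (hno _ (hker t))
  have := (countable_facetFunctionals X).to_subtype
  -- The n-tuple of facet functionals determines t: equal sums make multiples of two pencil members
  -- equal, and independence of f₀, f₁ with k s ≠ 0 gives s = t.
  refine not_countable (α := ℝ) (Function.Injective.countable (f := G) fun s t hst => ?_)
  have h : k s • (f₀ + s • f₁) = k t • (f₀ + t • f₁) := by rw [← hG, ← hG, hst]
  obtain ⟨h0, h1⟩ := hli (k s - k t) (k s * s - k t * t) (by
    rw [← sub_eq_zero] at h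
    rw [← h]
    module)
  rw [← sub_eq_zero.1 h0, ← mul_sub] at h1
  exact sub_eq_zero.1 ((mul_eq_zero.1 h1).resolve_left (hk s))
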